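/- Let $E$ be a complex Banach lattice, i.e. the complexification of a real Banach lattice $E_{\mathbb R}$, with positive cone $E_+$, and write $d_+(f) = \operatorname{dist}(f, E_+)$ for $f \in E$. Let $A : D(A) \subseteq E \to E$ be a closed linear operator with spectrum $\sigma(A)$, resolvent set $\rho(A)$ and resolvent $R(\lambda,A) = (\lambda - A)^{-1}$, and let $s(A) = \sup\{\operatorname{Re}\lambda : \lambda \in \sigma(A)\} \in [-\infty,\infty]$. Let $\lambda_0 \in \sigma(A) \cap \mathbb{R}$ be a simple pole of $R(\,\cdot\,,A)$, with spectral projection $P = \frac{1}{2\pi i}\oint R(\lambda,A)\,d\lambda$, the integral being taken over a small positively oriented circle around $\lambda_0$. The following assertions are equivalent. 1. $P$ is positive, i.e. $P E_+ \subseteq E_+$. 2. $R(\,\cdot\,,A)$ is individually asymptotically positive at $\lambda_0$, i.e. $(\lambda_0,\lambda_0+\varepsilon] \subset \rho(A)$ for some $\varepsilon > 0$, $\limsup_{\lambda \downarrow \lambda_0} \|(\lambda-\lambda_0)R(\lambda,A)\| < \infty$, and $(\lambda - \lambda_0)\, d_+(R(\lambda,A)f) \to 0$ as $\lambda \downarrow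 \lambda_0$ for every $f \in E_+$. 3. $R(\,\cdot\,,A)$ is uniformly asymptotically positive of bounded type at $\lambda_0$, i.e. $\limsup_{\lambda \downarrow \lambda_0} \|(\lambda-\lambda_0)R(\lambda,A)\| < \infty$ and there are $\lambda_1 > \lambda_0$ and $K \ge 0$ such that $(\lambda_0,\lambda_1] \subset \rho(A)$ and $d_+(R(\lambda,A)f) \le K\|f\|$ for all $f \in E_+$ and all $\lambda \in (\lambda_0,\lambda_1]$. If $\lambda_0 = s(A)$, then assertions 1–3 are also equivalent to each of the following, where, for a bounded operator $T$ on $E$ with spectral radius $r(T) > 0$ such that $T/r(T)$ is power bounded, $T$ is called individually asymptotically positive if $d_+\big((T/r(T))^n f\big) \to 0$ as $n \to \infty$ for every $f \in E_+$, and uniformly asymptotically positive if for every $\varepsilon > 0$ there is an $n_0$ such that $d_+\big((T/r(T))^n f\big) \le \varepsilon\|f\|$ for all $n \ge n_0$ and all $f \in E_+$ (both notions include the requirements that $r(T) > 0$ and that $T/r(T)$ be power bounded). 4. There is a real $\lambda > s(A)$ such that $R(\lambda,A)$ is individually asymptotically positive. 5. For every real $\lambda > s(A)$, the operator $R(\lambda,A)$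 is uniformly asymptotically positive. -/

import Mathlib

open Filter Topology

namespace AsymptoticPositivity

/-- `LatticeComplexification F E` exhibits the complex Banach space `E` as the complexification
of the real Banach lattice `F` (so `E` is a complex Banach lattice with real part `F`): every
`z : E` is uniquely `x + i y` with `x, y` in `F`, the modulus of `z` is
`|z| = sup_θ ((cos θ) x + (sin θ) y)`, taken in `F`, and `‖z‖ = ‖|z|‖`. -/
structure LatticeComplexification (F E : Type*)
    [NormedAddCommGroup F] [NormedSpace ℝ F] [Lattice F]
    [NormedAddCommGroup E] [NormedSpace ℂ E] where
  /-- the inclusion of the real part -/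
  ofReal : F →ₗ[ℝ] E
  existsUnique_decomp : ∀ z : E, ∃! p : F × F, z = ofReal p.1 + Complex.I • ofReal p.2
  norm_eq_norm_modulus : ∀ x y : F, ∃ m : F,
    IsLUB (Set.range fun θ : ℝ => Real.cos θ • x + Real.sin θ • y) m ∧
      ‖ofReal x + Complex.I • ofReal y‖ = ‖m‖

section Operators

variable {E : Type*} [NormedAddCommGroup E] [NormedSpace ℂ E]

/-- `R` is a bounded operator that is a two-sided inverse of `z - A : D(A) → E`. -/
def IsResolventAt (A : E →ₗ.[ℂ] E) (z : ℂ) (R : E →L[ℂ] E) : Prop :=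
  (∀ f : E, ∃ h : R f ∈ A.domain, z • R f - A ⟨R f, h⟩ = f) ∧
    ∀ u : A.domain, R (z • (u : E) - A u) = u

/-- There is at most one inverse of `z - A`. -/
theorem IsResolventAt.unique {A : E →ₗ.[ℂ] E} {z : ℂ} {R S : E →L[ℂ] E}
    (hR : IsResolventAt A z R) (hS : IsResolventAt A z S) : R = S := by
  ext f
  obtain ⟨h, hf⟩ := hR.1 f
  have := hS.2 ⟨R f, h⟩
  rw [hf] at this
  exact this.symm

/-- The resolvent set `ρ(A)`. -/
def resolventSet (A : E →ₗ.[ℂ] E) : Set ℂ :=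
  {z | ∃ R : E →L[ℂ] E, IsResolventAt A z R}

/-- The spectrum `σ(A)`. -/
def spectrum (A : E →ₗ.[ℂ] E) : Set ℂ :=
  (resolventSet A)ᶜ

open Classical in
/-- The resolvent `R(z, A) = (z - A)⁻¹` for `z ∈ ρ(A)` (and `0` for `z ∉ ρ(A)`). -/
noncomputable def resolvent (A : E →ₗ.[ℂ] E) (z : ℂ) : E →L[ℂ] E :=
  if h : ∃ R : E →L[ℂ] E, IsResolventAt A z R then h.choose else 0

/-- On the resolvent set, `resolvent A z` is the inverse of `z - A`. -/
theorem isResolventAt_resolvent {A : E →ₗ.[ℂ] E} {z : ℂ} (hz : z ∈ resolventSet A) :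
    IsResolventAt A z (resolvent A z) := by
  have h : ∃ R : E →L[ℂ] E, IsResolventAt A z R := hz
  rw [resolvent, dif_pos h]
  exact h.choose_spec

/-- The spectral bound `s(A) = sup {Re z : z ∈ σ(A)} ∈ [-∞, ∞]`. -/
noncomputable def spectralBound (A : E →ₗ.[ℂ] E) : EReal :=
  sSup ((fun z : ℂ => (z.re : EReal)) '' spectrum A)

/-- `z₀` is a spectral value and a pole of order one of the resolvent. -/
def IsSimplePole (A : E →ₗ.[ℂ] E) (z₀ : ℂ) : Prop :=
  z₀ ∈ spectrum A ∧ (∀ᶠ z in 𝓝[≠] z₀, z ∈ resolventSet A) ∧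
    meromorphicOrderAt (resolvent A) z₀ = -1

open Classical in
/-- The spectral projection `(2πi)⁻¹ ∮ R(z, A) dz` associated with an isolated point `z₀` of the
spectrum, integrated over a positively oriented circle around `z₀` such that the closed disc it
bounds meets the spectrum at most in `z₀` (and `0` if there is no such circle). -/
noncomputable def spectralProjection (A : E →ₗ.[ℂ] E) (z₀ : ℂ) : E →L[ℂ] E :=
  if h : ∃ r : ℝ, 0 < r ∧ Metric.closedBall z₀ r \ {z₀} ⊆ resolventSet A then
    (2 * Real.pi * Complex.I : ℂ)⁻¹ • ∮ z in C(z₀, h.choose), resolvent A z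
  else 0

/-- `(a, b] ⊆ ρ(A)` for real `a, b`. -/
def IocSubsetResolventSet (A : E →ₗ.[ℂ] E) (a b : ℝ) : Prop :=
  ∀ t ∈ Set.Ioc a b, (t : ℂ) ∈ resolventSet A

/-- The requirements on `l₀ ∈ ℝ` under which asymptotic positivity of the resolvent at `l₀` is
defined: `l₀ ∈ σ(A)`, `(l₀, l₀ + ε] ⊆ ρ(A)` for some `ε > 0`, and
`limsup_{t ↓ l₀} ‖(t - l₀) R(t, A)‖ < ∞`. -/
def AbelGrowth (A : E →ₗ.[ℂ] E) (l₀ : ℝ) : Prop :=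
  (l₀ : ℂ) ∈ spectrum A ∧ (∃ ε > 0, IocSubsetResolventSet A l₀ (l₀ + ε)) ∧
    limsup (fun t : ℝ => ‖(t - l₀) • resolvent A t‖ₑ) (𝓝[>] l₀) < ⊤

/-- The spectral radius of a bounded operator, as a real number. -/
noncomputable def spr (T : E →L[ℂ] E) : ℝ := (spectralRadius ℂ T).toReal

/-- `r(T) > 0` and `T / r(T)` is power bounded. -/
def NormalizedPowerBounded (T : E →L[ℂ] E) : Prop :=
  0 < spr T ∧ ∃ C : ℝ, ∀ n : ℕ, ‖((spr T)⁻¹ • T) ^ n‖ ≤ C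

end Operators

namespace LatticeComplexification

variable {F E : Type*} [NormedAddCommGroup F] [NormedSpace ℝ F] [Lattice F]
  [NormedAddCommGroup E] [NormedSpace ℂ E] (J : LatticeComplexification F E)

/-- The positive cone `E₊`. -/
def cone : Set E := J.ofReal '' {x : F | 0 ≤ x}

/-- The distance `d₊(f)` of `f` to the positive cone. -/
noncomputable def distPos (f : E) : ℝ := Metric.infDist f J.cone

/-- `T ≥ 0`, that is `T E₊ ⊆ E₊`. -/
def IsPositive (T : E →L[ℂ] E) : Prop := ∀ f ∈ J.cone, T f ∈ J.cone

/-- The resolvent of `A` is individually asymptotically positive at `l₀`. -/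
def ResolventIndivAsympPos (A : E →ₗ.[ℂ] E) (l₀ : ℝ) : Prop :=
  AbelGrowth A l₀ ∧ ∀ f ∈ J.cone,
    Tendsto (fun t : ℝ => (t - l₀) * J.distPos (resolvent A t f)) (𝓝[>] l₀) (𝓝 0)

/-- The resolvent of `A` is uniformly asymptotically positive of bounded type at `l₀`. -/
def ResolventUnifAsympPosBddType (A : E →ₗ.[ℂ] E) (l₀ : ℝ) : Prop :=
  AbelGrowth A l₀ ∧ ∃ l₁ > l₀, ∃ K ≥ (0 : ℝ), IocSubsetResolventSet A l₀ l₁ ∧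
    ∀ f ∈ J.cone, ∀ t ∈ Set.Ioc l₀ l₁, J.distPos (resolvent A (t : ℂ) f) ≤ K * ‖f‖

/-- The bounded operator `T` is individually asymptotically positive. -/
def IndivAsympPos (T : E →L[ℂ] E) : Prop :=
  NormalizedPowerBounded T ∧ ∀ f ∈ J.cone,
    Tendsto (fun n : ℕ => J.distPos ((((spr T)⁻¹ • T) ^ n) f)) atTop (𝓝 0)

/-- The bounded operator `T` is uniformly asymptotically positive. -/
def UnifAsympPos (T : E →L[ℂ] E) : Prop :=
  NormalizedPowerBounded T ∧ ∀ ε > (0 : ℝ), ∃ n₀ : ℕ, ∀ n ≥ n₀, ∀ f ∈ J.cone,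
    J.distPos ((((spr T)⁻¹ • T) ^ n) f) ≤ ε * ‖f‖

end LatticeComplexification

end AsymptoticPositivity

/-! Near a simple pole the resolvent is `(z - l₀)⁻¹ • Q + H z` with `H` continuous at `l₀`, and
Cauchy's formula identifies `Q` with the spectral projection (`spectralProjection_eq`). If `Q` is
positive, then `(t - l₀)⁻¹ • Q f` is a point of the cone within `‖H t‖ ‖f‖` of `R(t, A) f`, which is
a bounded error. Conversely `(t - l₀) R(t, A) → Q`, and the cone is closed, so asymptotic positivity
passes to `Q`.

If `l₀ = s(A)`, put `S = (l - l₀) R(l, A)`. Its spectral radius is 1 and `S Q = Q`. The map `z ↦ (l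
- l₀) / (l - z)` carries the spectrum of `A` into the closed unit disc and meets the unit circle
only at the image 1 of `l₀`. Splitting off `Q` removes that value, so `S (1 - Q)` has spectral
radius below 1 and `S ^ n → Q` in norm (`tendsto_pow_resolvent`). The two statements about powers
then follow by the same argument as for the resolvent. -/

namespace AsymptoticPositivity

/-! ### Resolvent calculus for an unbounded operator. -/

section Operators

variable {E : Type*} [NormedAddCommGroup E] [NormedSpace ℂ E] {A : E →ₗ.[ℂ] E}

theorem IsResolventAt.resolvent_eq {z : ℂ} {R : E →L[ℂ] E} (h : IsResolventAt A z R) :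
    resolvent A z = R :=
  (isResolventAt_resolvent ⟨R, h⟩).unique h

/-- The resolvent identity. -/
theorem resolvent_sub_resolvent {z w : ℂ} (hz : z ∈ resolventSet A) (hw : w ∈ resolventSet A) :
    resolvent A z - resolvent A w = (w - z) • (resolvent A z * resolvent A w) := by
  ext f
  obtain ⟨h, hf⟩ := (isResolventAt_resolvent hw).1 f
  have h2 := (isResolventAt_resolvent hz).2 ⟨resolvent A w f, h⟩
  have h3 : resolvent A z f - (w - z) • resolvent A z (resolvent A w f) = resolvent A w f := by
    refine Eq.trans ?_ h2
    rw [← map_smul, ← map_sub]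
    congr 1
    nth_rewrite 1 [← hf]
    module
  change resolvent A z f - resolvent A w f = (w - z) • resolvent A z (resolvent A w f)
  nth_rewrite 1 [← h3]
  abel

theorem resolvent_commute (z w : ℂ) : Commute (resolvent A z) (resolvent A w) := by
  by_cases hz : z ∈ resolventSet A
  swap
  · have : resolvent A z = 0 := dif_neg hz
    rw [this]; exact Commute.zero_left _
  by_cases hw : w ∈ resolventSet A
  swap
  · have : resolvent A w = 0 := dif_neg hw
    rw [this]; exact Commute.zero_right _
  rcases eq_or_ne z w with rfl | hne
  · exact Commute.refl _
  have h1 := resolvent_sub_resolvent hz hw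
  have h2 := resolvent_sub_resolvent hw hz
  have h3 : (w - z) • (resolvent A z * resolvent A w)
      = (w - z) • (resolvent A w * resolvent A z) := by
    rw [← h1, ← neg_sub, h2, ← neg_smul, neg_sub]
  exact smul_right_injective _ (sub_ne_zero.2 hne.symm) h3

/-- The factors are `(w - A) R(z, A)` and `(z - A) R(w, A)`, hence mutually inverse. -/
theorem one_add_smul_resolvent_mul {z w : ℂ} (hz : z ∈ resolventSet A) (hw : w ∈ resolventSet A) :
    (1 + (w - z) • resolvent A z) * (1 - (w - z) • resolvent A w) = 1 := by
  have h := resolvent_sub_resolvent hz hw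
  have : (1 + (w - z) • resolvent A z) * (1 - (w - z) • resolvent A w)
      = 1 + (w - z) • ((resolvent A z - resolvent A w)
        - (w - z) • (resolvent A z * resolvent A w)) := by
    simp only [add_mul, mul_sub, one_mul, mul_one, smul_mul_assoc, mul_smul_comm]
    module
  rw [this, h]
  simp

/-- If `1 + (w - z) R(z, A)` is invertible then `w ∈ ρ(A)`. -/
theorem isResolventAt_of_isUnit {z w : ℂ} (hz : z ∈ resolventSet A)
    (hu : IsUnit (1 + (w - z) • resolvent A z)) :
    IsResolventAt A w (resolvent A z * Ring.inverse (1 + (w - z) • resolvent A z)) := by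
  set R := resolvent A z with hR
  set U := 1 + (w - z) • R with hU
  set V := Ring.inverse U with hV
  have hUV : U * V = 1 := Ring.mul_inverse_cancel _ hu
  have hVU : V * U = 1 := Ring.inverse_mul_cancel _ hu
  have hcomm : R * V = V * R := by
    have hc : Commute U R := by
      rw [hU]
      exact (Commute.one_left R).add_left ((Commute.refl R).smul_left _)
    calc R * V = (V * U) * R * V := by rw [hVU, one_mul]
      _ = V * (U * R) * V := by rw [mul_assoc V]
      _ = V * R * (U * V) := by rw [hc.eq]; simp only [mul_assoc]
      _ = V * R := by rw [hUV, mul_one]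
  constructor
  · intro f
    obtain ⟨h, hf⟩ := (isResolventAt_resolvent hz).1 (V f)
    refine ⟨h, ?_⟩
    have h1 : V f + (w - z) • R (V f) = f := by
      have := congrArg (fun T : E →L[ℂ] E => T f) hUV
      simpa [hU] using this
    change w • R (V f) - A ⟨R (V f), h⟩ = f
    have hf' : A ⟨R (V f), h⟩ = z • R (V f) - V f := by
      rw [eq_sub_iff_add_eq, add_comm]
      exact (sub_eq_iff_eq_add.1 hf).symm
    refine Eq.trans ?_ h1
    rw [hf']
    module
  · intro u
    have h1 := (isResolventAt_resolvent hz).2 u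
    rw [← hR] at h1
    rw [hcomm]
    change V (R (w • (u : E) - A u)) = u
    have h2 : R (w • (u : E) - A u) = U u := by
      have : w • (u : E) - A u = (z • (u : E) - A u) + (w - z) • (u : E) := by module
      rw [this, map_add, h1, map_smul]
      simp [hU]
    rw [h2]
    have := congrArg (fun T : E →L[ℂ] E => T (u : E)) hVU
    simpa using this

/-- For `k ≠ 0` and `z = l - 1 / k`, one has `k ∈ σ(R(l, A))` iff `z ∈ σ(A)`. -/
theorem mem_spectrum_resolvent_iff {l : ℂ} (hl : l ∈ resolventSet A) {k : ℂ} (hk : k ≠ 0) :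
    k ∈ _root_.spectrum ℂ (resolvent A l) ↔ l - k⁻¹ ∈ spectrum A := by
  have h1 : algebraMap ℂ (E →L[ℂ] E) k - resolvent A l
      = k • (1 + ((l - k⁻¹) - l) • resolvent A l) := by
    rw [smul_add, smul_smul, Algebra.algebraMap_eq_smul_one]
    have : k * (l - k⁻¹ - l) = -1 := by field_simp; ring
    rw [this, neg_one_smul, sub_eq_add_neg]
  rw [_root_.spectrum.mem_iff, h1, spectrum, Set.mem_compl_iff, not_iff_not,
    ← Units.smul_mk0 hk, isUnit_smul_iff]
  refine ⟨fun h => ⟨_, isResolventAt_of_isUnit hl h⟩, fun h => ?_⟩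
  have hc : Commute (1 + ((l - k⁻¹) - l) • resolvent A l)
      (1 - ((l - k⁻¹) - l) • resolvent A (l - k⁻¹)) :=
    (Commute.one_left _).add_left (((Commute.one_right _).sub_right
      ((resolvent_commute _ _).smul_right _)).smul_left _)
  have := one_add_smul_resolvent_mul hl h
  exact ⟨⟨_, _, this, hc.eq ▸ this⟩, rfl⟩

theorem differentiableAt_resolvent [CompleteSpace E] {z : ℂ} (hz : z ∈ resolventSet A) :
    DifferentiableAt ℂ (resolvent A) z := by
  set U : ℂ → (E →L[ℂ] E) := fun w => 1 + (w - z) • resolvent A z with hU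
  have hUd : DifferentiableAt ℂ U z := by fun_prop
  have hUz : U z = 1 := by simp [hU]
  -- Units form an open set, so this formula reduces the claim to differentiability of inversion.
  have hev : ∀ᶠ w in 𝓝 z, resolvent A w = resolvent A z * Ring.inverse (U w) := by
    have : ∀ᶠ w in 𝓝 z, IsUnit (U w) :=
      hUd.continuousAt (Units.isOpen.mem_nhds (by simp [hUz]))
    filter_upwards [this] with w hw
    exact (isResolventAt_of_isUnit hz hw).resolvent_eq
  refine DifferentiableAt.congr_of_eventuallyEq ?_ hev
  have : DifferentiableAt ℂ (Ring.inverse : (E →L[ℂ] E) → _) (U z) :=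
    differentiableAt_inverse (by simp [hUz])
  exact (differentiableAt_const _).mul (this.comp z hUd)

/-! ### Laurent expansion at the pole and properties of the residue. -/

theorem IsSimplePole.exists_laurent {l₀ : ℂ} (h : IsSimplePole A l₀) :
    ∃ (Q : E →L[ℂ] E) (H : ℂ → E →L[ℂ] E), Q ≠ 0 ∧ ContinuousAt H l₀ ∧
      ∀ᶠ z in 𝓝[≠] l₀, resolvent A z = (z - l₀)⁻¹ • Q + H z := by
  obtain ⟨-, -, ho⟩ := h
  -- `meromorphicOrderAt` is 0 for functions that are not meromorphic, so order `-1` forces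
  -- meromorphy.
  have hm : MeromorphicAt (resolvent A) l₀ :=
    meromorphicAt_of_meromorphicOrderAt_ne_zero (by rw [ho]; decide)
  obtain ⟨g, hg, hg0, hgev⟩ := (meromorphicOrderAt_eq_int_iff (n := -1) hm).1 ho
  refine ⟨g l₀, dslope g l₀, hg0, continuousAt_dslope_same.2 hg.differentiableAt, ?_⟩
  filter_upwards [hgev, self_mem_nhdsWithin] with z hz hne
  have hne' : z - l₀ ≠ 0 := sub_ne_zero.2 hne
  rw [hz, dslope_of_ne _ hne, slope, vsub_eq_sub, zpow_neg_one, smul_sub]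
  abel

variable {l₀ : ℂ} {Q : E →L[ℂ] E} {H : ℂ → E →L[ℂ] E}

theorem tendsto_sub_smul_resolvent (hH : ContinuousAt H l₀)
    (hQ : ∀ᶠ z in 𝓝[≠] l₀, resolvent A z = (z - l₀)⁻¹ • Q + H z) :
    Tendsto (fun z => (z - l₀) • resolvent A z) (𝓝[≠] l₀) (𝓝 Q) := by
  have h1 : Tendsto (fun z => Q + (z - l₀) • H z) (𝓝 l₀) (𝓝 (Q + (l₀ - l₀) • H l₀)) := by
    have : ContinuousAt (fun z => Q + (z - l₀) • H z) l₀ := by fun_prop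
    exact this
  rw [sub_self, zero_smul, add_zero] at h1
  refine (h1.mono_left nhdsWithin_le_nhds).congr' ?_
  filter_upwards [hQ, self_mem_nhdsWithin] with z hz hne
  have hne' : z - l₀ ≠ 0 := sub_ne_zero.2 hne
  rw [hz, smul_add, smul_smul, mul_inv_cancel₀ hne', one_smul]

/-- Cauchy's formula for `(z - l₀) R(z, A)`, whose singularity at `l₀` is removable with value `Q`;
the radius chosen in the definition is therefore irrelevant. -/
theorem spectralProjection_eq [CompleteSpace E]
    (hev : ∀ᶠ z in 𝓝[≠] l₀, z ∈ resolventSet A)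
    (hlim : Tendsto (fun z => (z - l₀) • resolvent A z) (𝓝[≠] l₀) (𝓝 Q)) :
    spectralProjection A l₀ = Q := by
  have hex : ∃ r : ℝ, 0 < r ∧ Metric.closedBall l₀ r \ {l₀} ⊆ resolventSet A := by
    rw [eventually_nhdsWithin_iff, Metric.nhds_basis_closedBall.eventually_iff] at hev
    obtain ⟨r, hr, hr'⟩ := hev
    exact ⟨r, hr, fun z hz => hr' hz.1 hz.2⟩
  rw [spectralProjection, dif_pos hex]
  obtain ⟨hr, hsub⟩ := hex.choose_spec
  set r := hex.choose
  have hd : ∀ z ∈ Metric.closedBall l₀ r \ {l₀},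
      DifferentiableAt ℂ (fun z => (z - l₀) • resolvent A z) z := fun z hz =>
    (differentiableAt_id.sub_const _).smul (differentiableAt_resolvent (hsub hz))
  have key := Complex.circleIntegral_sub_center_inv_smul_of_differentiable_on_off_countable_of_tendsto
    hr Set.countable_empty (f := fun z => (z - l₀) • resolvent A z) (y := Q)
    (fun z hz => (hd z hz).continuousAt.continuousWithinAt)
    (fun z hz => hd z ⟨Metric.ball_subset_closedBall hz.1.1, by simpa using hz.1.2⟩) hlim
  have hint : (∮ z in C(l₀, r), resolvent A z)
      = ∮ z in C(l₀, r), (z - l₀)⁻¹ • (z - l₀) • resolvent A z := by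
    refine circleIntegral.integral_congr hr.le fun z hz => ?_
    have hne : z - l₀ ≠ 0 := by
      intro h0
      have : dist z l₀ = r := hz
      rw [dist_eq_norm, h0, norm_zero] at this
      exact hr.ne this
    simp only [smul_smul, inv_mul_cancel₀ hne, one_smul]
  rw [hint, key, smul_smul, inv_mul_cancel₀, one_smul]
  simp [Real.pi_ne_zero]

theorem commute_of_tendsto_sub_smul_resolvent
    (hlim : Tendsto (fun z => (z - l₀) • resolvent A z) (𝓝[≠] l₀) (𝓝 Q)) (w : ℂ) :
    Commute (resolvent A w) Q :=
  tendsto_nhds_unique (hlim.const_mul _) <| (hlim.mul_const (resolvent A w)).congr fun z =>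
    (((resolvent_commute w z).smul_right (z - l₀)).eq).symm

/-- Multiply the resolvent identity for `w` and `z` by `z - l₀` and let `z → l₀`. -/
theorem sub_smul_resolvent_mul (hev : ∀ᶠ z in 𝓝[≠] l₀, z ∈ resolventSet A)
    (hlim : Tendsto (fun z => (z - l₀) • resolvent A z) (𝓝[≠] l₀) (𝓝 Q))
    {w : ℂ} (hw : w ∈ resolventSet A) : (w - l₀) • (resolvent A w * Q) = Q := by
  have hz0 : Tendsto (fun z : ℂ => z - l₀) (𝓝[≠] l₀) (𝓝 0) := by
    have : ContinuousAt (fun z : ℂ => z - l₀) l₀ := by fun_prop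
    simpa using this.tendsto.mono_left nhdsWithin_le_nhds
  have hzw : Tendsto (fun z : ℂ => z - w) (𝓝[≠] l₀) (𝓝 (l₀ - w)) := by
    have : ContinuousAt (fun z : ℂ => z - w) l₀ := by fun_prop
    exact this.tendsto.mono_left nhdsWithin_le_nhds
  have h1 : Tendsto (fun z => (z - l₀) • resolvent A w - (z - l₀) • resolvent A z)
      (𝓝[≠] l₀) (𝓝 ((0 : ℂ) • resolvent A w - Q)) := (hz0.smul_const _).sub hlim
  have h2 : Tendsto (fun z => (z - w) • (resolvent A w * ((z - l₀) • resolvent A z)))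
      (𝓝[≠] l₀) (𝓝 ((l₀ - w) • (resolvent A w * Q))) := hzw.smul (hlim.const_mul _)
  have h3 := tendsto_nhds_unique h1 (h2.congr' (by
    filter_upwards [hev] with z hz
    rw [← smul_sub, resolvent_sub_resolvent hw hz, mul_smul_comm, smul_comm]))
  rw [zero_smul, zero_sub, ← neg_sub, neg_smul, neg_inj] at h3
  exact h3.symm

theorem mul_self_of_tendsto_sub_smul_resolvent (hev : ∀ᶠ z in 𝓝[≠] l₀, z ∈ resolventSet A)
    (hlim : Tendsto (fun z => (z - l₀) • resolvent A z) (𝓝[≠] l₀) (𝓝 Q)) : Q * Q = Q := by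
  refine tendsto_nhds_unique (hlim.mul_const Q) (tendsto_const_nhds.congr' ?_)
  filter_upwards [hev] with w hw
  rw [smul_mul_assoc, sub_smul_resolvent_mul hev hlim hw]

/-- The element is block diagonal for the idempotent `p`: `a` on the block of `1 - p`, where `v`
inverts it, and the nonzero scalar `w` on the block of `p`. -/
theorem isUnit_mul_one_sub_add_smul {R : Type*} [Ring R] [Algebra ℂ R] {a v p : R} {w : ℂ}
    (hav : Commute a v) (hap : Commute a p) (hvp : Commute v p) (hp : p * p = p)
    (h : a * v * (1 - p) = 1 - p) (hw : w ≠ 0) : IsUnit (a * (1 - p) + w • p) := by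
  have hpp : (1 - p) * (1 - p) = 1 - p := by simp [mul_sub, sub_mul, hp]
  have h1p : (1 - p) * p = 0 := by simp [sub_mul, hp]
  have hp1 : p * (1 - p) = 0 := by simp [mul_sub, hp]
  have hap' : Commute a (1 - p) := (Commute.one_right a).sub_right hap
  have hvp' : Commute v (1 - p) := (Commute.one_right v).sub_right hvp
  have key : (a * (1 - p) + w • p) * (v * (1 - p) + w⁻¹ • p) = 1 := by
    have e1 : a * (1 - p) * (v * (1 - p)) = 1 - p := by
      rw [← mul_assoc, mul_assoc a, ← hvp'.eq, ← mul_assoc, mul_assoc, hpp, h]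
    have e2 : a * (1 - p) * (w⁻¹ • p) = 0 := by
      rw [mul_smul_comm, mul_assoc, h1p, mul_zero, smul_zero]
    have e3 : w • p * (v * (1 - p)) = 0 := by
      rw [smul_mul_assoc, hvp'.eq, ← mul_assoc, hp1, zero_mul, smul_zero]
    have e4 : w • p * (w⁻¹ • p) = p := by
      rw [smul_mul_smul_comm, hp, mul_inv_cancel₀ hw, one_smul]
    rw [add_mul, mul_add, mul_add, e1, e2, e3, e4]
    abel
  have hpc : Commute p (1 - p) := (Commute.one_right p).sub_right (Commute.refl p)
  have hc : Commute (a * (1 - p) + w • p) (v * (1 - p) + w⁻¹ • p) :=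
    ((hav.mul_right hap').mul_left (hvp'.symm.mul_right (Commute.refl _))).add_right
      ((hap.mul_left hpc.symm).smul_right _) |>.add_left
      (((hvp.symm.mul_right hpc).add_right ((Commute.refl p).smul_right _)).smul_left _)
  exact ⟨⟨_, _, key, hc.eq ▸ key⟩, rfl⟩

/-- Powers of an element of a Banach algebra with spectral radius less than one tend to zero. -/
theorem tendsto_pow_zero_of_spectralRadius_lt_one {B : Type*} [NormedRing B] [NormedAlgebra ℂ B]
    [CompleteSpace B] {b : B} (hb : spectralRadius ℂ b < 1) :
    Tendsto (fun n => b ^ n) atTop (𝓝 0) := by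
  obtain ⟨q, hq1, hq2⟩ := ENNReal.lt_iff_exists_nnreal_btwn.1 hb
  have hq : (q : ℝ) < 1 := by exact_mod_cast hq2
  have hev := (spectrum.pow_nnnorm_pow_one_div_tendsto_nhds_spectralRadius b).eventually
    (gt_mem_nhds hq1)
  refine squeeze_zero_norm' ?_ (tendsto_pow_atTop_nhds_zero_of_lt_one q.2 hq)
  filter_upwards [hev, eventually_gt_atTop 0] with n hn hn0
  have hn0' : (n : ℝ) ≠ 0 := by positivity
  have := ENNReal.rpow_le_rpow hn.le (Nat.cast_nonneg (α := ℝ) n)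
  rw [← ENNReal.rpow_mul, one_div_mul_cancel hn0', ENNReal.rpow_one, ENNReal.rpow_natCast] at this
  exact_mod_cast this

end Operators

end AsymptoticPositivity
namespace AsymptoticPositivity

/-! ### Powers of the resolvent when the pole dominates the spectrum. -/

section Dominant

variable {E : Type*} [NormedAddCommGroup E] [NormedSpace ℂ E] {A : E →ₗ.[ℂ] E}
  {l₀ : ℂ} {Q : E →L[ℂ] E} {H : ℂ → E →L[ℂ] E}

theorem tendsto_resolvent_sub (hH : ContinuousAt H l₀)
    (hQ : ∀ᶠ z in 𝓝[≠] l₀, resolvent A z = (z - l₀)⁻¹ • Q + H z) :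
    Tendsto (fun z => resolvent A z - (z - l₀)⁻¹ • Q) (𝓝[≠] l₀) (𝓝 (H l₀)) := by
  refine (hH.tendsto.mono_left nhdsWithin_le_nhds).congr' ?_
  filter_upwards [hQ] with z hz
  rw [hz, add_sub_cancel_left]

/-- An operator commuting with the resolvent and the residue commutes with the constant term of
the Laurent expansion. -/
theorem commute_constantTerm (hH : ContinuousAt H l₀)
    (hQ : ∀ᶠ z in 𝓝[≠] l₀, resolvent A z = (z - l₀)⁻¹ • Q + H z) {T : E →L[ℂ] E}
    (hT : ∀ z, Commute T (resolvent A z)) (hTQ : Commute T Q) : Commute T (H l₀) := by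
  have hlim := tendsto_resolvent_sub hH hQ
  exact tendsto_nhds_unique (hlim.const_mul T) <| (hlim.mul_const T).congr fun z =>
    (((hT z).sub_right (hTQ.smul_right _)).eq).symm

/-- On the kernel of the residue, the constant term of the Laurent expansion inverts `l₀ - A`. -/
theorem one_add_smul_resolvent_mul_constantTerm (hev : ∀ᶠ z in 𝓝[≠] l₀, z ∈ resolventSet A)
    (hH : ContinuousAt H l₀)
    (hQ : ∀ᶠ z in 𝓝[≠] l₀, resolvent A z = (z - l₀)⁻¹ • Q + H z)
    (hQQ : Q * Q = Q) {l : ℂ} (hl : l ∈ resolventSet A) :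
    (1 + (l₀ - l) • resolvent A l) * (1 - (l₀ - l) • H l₀) * (1 - Q) = 1 - Q := by
  have hQ1 : Q * (1 - Q) = 0 := by rw [mul_sub, mul_one, hQQ, sub_self]
  have hc : ContinuousAt
      (fun z => (1 + (z - l) • resolvent A l) * (1 - (z - l) • H z) * (1 - Q)) l₀ := by
    fun_prop
  refine tendsto_nhds_unique (hc.tendsto.mono_left (nhdsWithin_le_nhds (s := {l₀}ᶜ)))
    (tendsto_const_nhds.congr' ?_)
  filter_upwards [hev, hQ] with z hz hzQ
  have h1 : (1 - (z - l) • H z) * (1 - Q) = (1 - (z - l) • resolvent A z) * (1 - Q) := by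
    rw [hzQ, sub_mul, sub_mul (1 : E →L[ℂ] E), smul_mul_assoc, smul_mul_assoc, add_mul,
      smul_mul_assoc, hQ1, smul_zero, zero_add]
  rw [mul_assoc, h1, ← mul_assoc, one_add_smul_resolvent_mul hl hz, one_mul]

/-- A point of a half plane bounded by the vertical line through `l₀`, at distance at most `l - l₀`
of the point `l` on the other side, is `l₀`. -/
theorem eq_of_re_le_of_norm_sub_le {l l₀ : ℝ} {z : ℂ} (hl : l₀ < l) (hz : z.re ≤ l₀)
    (h : ‖(l : ℂ) - z‖ ≤ l - l₀) : z = l₀ := by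
  have h1 : ‖(l : ℂ) - z‖ ^ 2 ≤ (l - l₀) ^ 2 := by gcongr
  rw [← Complex.normSq_eq_norm_sq, Complex.normSq_apply] at h1
  simp only [Complex.sub_re, Complex.ofReal_re, Complex.sub_im, Complex.ofReal_im, zero_sub] at h1
  have him : z.im = 0 := by nlinarith [sq_nonneg z.im]
  have hre : z.re = l₀ := by nlinarith [sq_nonneg z.im]
  exact Complex.ext (by simpa using hre) (by simpa using him)

/-- Nonzero spectral values of `R(l, A)` are `1 / (l - z)` with `z ∈ σ(A)`, and among points with
`Re z ≤ l₀` the distance to `l` is least at `l₀`. -/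
theorem spr_resolvent {l₀ l : ℝ} (hlt : l₀ < l) (h0 : (l₀ : ℂ) ∈ spectrum A)
    (hσ : ∀ z ∈ spectrum A, z.re ≤ l₀) (hl : (l : ℂ) ∈ resolventSet A) :
    spr (resolvent A l) = (l - l₀)⁻¹ := by
  have hpos : 0 < l - l₀ := sub_pos.2 hlt
  have hne : ((l : ℂ) - l₀) ≠ 0 := by exact_mod_cast hpos.ne'
  have hmem : ((l : ℂ) - l₀)⁻¹ ∈ _root_.spectrum ℂ (resolvent A l) := by
    rw [mem_spectrum_resolvent_iff hl (inv_ne_zero hne), inv_inv, sub_sub_cancel]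
    exact h0
  have hnorm : ‖((l : ℂ) - l₀)⁻¹‖ₑ = ENNReal.ofReal (l - l₀)⁻¹ := by
    rw [← ofReal_norm, norm_inv, ← Complex.ofReal_sub, Complex.norm_real,
      Real.norm_of_nonneg hpos.le]
  have : spectralRadius ℂ (resolvent A l) = ENNReal.ofReal (l - l₀)⁻¹ := by
    refine le_antisymm (iSup₂_le fun k hk => ?_) ?_
    · rcases eq_or_ne k 0 with rfl | hk0
      · simp
      have hz := (mem_spectrum_resolvent_iff hl hk0).1 hk
      have hre := hσ _ hz
      have h1 : l - l₀ ≤ ‖k⁻¹‖ := by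
        have h2 := Complex.re_le_norm k⁻¹
        simp only [Complex.sub_re, Complex.ofReal_re] at hre
        linarith
      have h3 : ‖k‖ ≤ (l - l₀)⁻¹ := by
        rw [norm_inv] at h1
        exact (le_inv_comm₀ hpos (norm_pos_iff.2 hk0)).1 h1
      change ‖k‖ₑ ≤ _
      rw [← ofReal_norm]
      exact ENNReal.ofReal_le_ofReal h3
    · rw [← hnorm]
      exact le_iSup₂ (f := fun (k : ℂ) (_ : k ∈ _root_.spectrum ℂ (resolvent A l)) =>
        (‖k‖₊ : ENNReal)) _ hmem
  rw [spr, this, ENNReal.toReal_ofReal (by positivity)]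

/-- If the spectral bound is a simple pole, then the normalized powers of the resolvent converge to
the spectral projection in operator norm. -/
theorem tendsto_pow_resolvent [CompleteSpace E] {l₀ l : ℝ} (hlt : l₀ < l)
    (hσ : ∀ z ∈ spectrum A, z.re ≤ l₀) (hl : (l : ℂ) ∈ resolventSet A)
    (hev : ∀ᶠ z in 𝓝[≠] (l₀ : ℂ), z ∈ resolventSet A) (hQ0 : Q ≠ 0)
    (hH : ContinuousAt H l₀)
    (hQ : ∀ᶠ z in 𝓝[≠] (l₀ : ℂ), resolvent A z = (z - l₀)⁻¹ • Q + H z) :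
    Tendsto (fun n => (((l : ℂ) - l₀) • resolvent A l) ^ n) atTop (𝓝 Q) := by
  have hpos : 0 < l - l₀ := sub_pos.2 hlt
  set μ : ℂ := (l : ℂ) - l₀ with hμ
  have hμ0 : μ ≠ 0 := by rw [hμ]; exact_mod_cast hpos.ne'
  have hμn : ‖μ‖ = l - l₀ := by
    rw [hμ, ← Complex.ofReal_sub, Complex.norm_real, Real.norm_of_nonneg hpos.le]
  set S := μ • resolvent A l with hS
  have hlim := tendsto_sub_smul_resolvent hH hQ
  have hcQ := commute_of_tendsto_sub_smul_resolvent hlim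
  have hQQ := mul_self_of_tendsto_sub_smul_resolvent hev hlim
  have hSQ : S * Q = Q := by
    rw [hS, smul_mul_assoc]
    exact sub_smul_resolvent_mul hev hlim hl
  have hScQ : Commute S Q := (hcQ _).smul_left _
  -- Nontriviality makes spectra nonempty, so a pointwise strict bound on the spectrum bounds the
  -- spectral radius strictly.
  have hnt : Nontrivial (E →L[ℂ] E) := ⟨Q, 0, hQ0⟩
  have hrad : spectralRadius ℂ (S * (1 - Q)) < 1 := by
    refine spectrum.spectralRadius_lt_of_forall_lt (r := 1) _ fun w hw => ?_
    by_contra! hw1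
    have hw1' : 1 ≤ ‖w‖ := by exact_mod_cast hw1
    have hw0 : w ≠ 0 := by
      rintro rfl
      simp at hw1'
      linarith
    refine hw ?_
    have hrepr : algebraMap ℂ (E →L[ℂ] E) w - S * (1 - Q) = (w • 1 - S) * (1 - Q) + w • Q := by
      rw [Algebra.algebraMap_eq_smul_one, sub_mul, smul_mul_assoc w 1, one_mul, smul_sub]
      abel
    rw [_root_.spectrum.mem_resolventSet_iff, hrepr]
    have haQ : Commute (w • 1 - S) Q := ((Commute.one_left Q).smul_left w).sub_left hScQ
    have haR : ∀ z, Commute (w • 1 - S) (resolvent A z) := fun z =>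
      ((Commute.one_left _).smul_left w).sub_left ((resolvent_commute _ _).smul_left _)
    -- `l - μ / w` is the point of the plane of `A` corresponding to the value `w` of `S`. If it is
    -- in `ρ(A)`, then `w - S` is itself invertible.
    by_cases hz : (l : ℂ) - μ / w ∈ resolventSet A
    · have hzl : w * ((l : ℂ) - μ / w - l) = -μ := by field_simp; ring
      have hS' : w • 1 - S = w • (1 + ((l : ℂ) - μ / w - l) • resolvent A l) := by
        rw [smul_add, smul_smul, hzl, neg_smul, sub_eq_add_neg]
      refine isUnit_mul_one_sub_add_smul
        (v := w⁻¹ • (1 - ((l : ℂ) - μ / w - l) • resolvent A ((l : ℂ) - μ / w)))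
        (((Commute.one_right _).sub_right ((haR _).smul_right _)).smul_right _) haQ
        (((Commute.one_left _).sub_left ((hcQ _).smul_left _)).smul_left _) hQQ ?_ hw0
      rw [hS', smul_mul_smul_comm, mul_inv_cancel₀ hw0, one_add_smul_resolvent_mul hl hz,
        one_smul, one_mul]
    -- Since `‖w‖ ≥ 1`, the point lies in the disc about `l` of radius `l - l₀`, which touches the
    -- half plane containing `σ(A)` only at `l₀`. Then `w = 1`, and `H l₀` supplies the inverse on
    -- the kernel of `Q`.
    · have hz0 : (l : ℂ) - μ / w = l₀ := by
        refine eq_of_re_le_of_norm_sub_le hlt (hσ _ hz) ?_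
        rw [sub_sub_cancel, norm_div, hμn]
        exact div_le_self hpos.le hw1'
      have hw' : w = 1 := by
        have : μ / w = μ := by rw [hμ]; linear_combination -hz0
        rw [div_eq_iff hw0] at this
        exact mul_left_cancel₀ hμ0 (by rw [mul_one]; exact this.symm)
      subst hw'
      have hS' : (1 : ℂ) • 1 - S = 1 + ((l₀ : ℂ) - l) • resolvent A l := by
        rw [one_smul, hS, hμ, sub_eq_add_neg, ← neg_smul, neg_sub]
      refine isUnit_mul_one_sub_add_smul (v := 1 - ((l₀ : ℂ) - l) • H l₀)
        ((Commute.one_right _).sub_right ((commute_constantTerm hH hQ haR haQ).smul_right _)) haQ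
        ((Commute.one_left _).sub_left (((commute_constantTerm hH hQ (fun z => (hcQ z).symm)
          (Commute.refl Q)).symm).smul_left _)) hQQ ?_ hw0
      rw [hS']
      exact one_add_smul_resolvent_mul_constantTerm hev hH hQ hQQ hl
  have hidem : IsIdempotentElem (1 - Q) := IsIdempotentElem.one_sub hQQ
  -- The shift is needed: at exponent 0 the right side would be `1 + Q`.
  have hpow : ∀ n : ℕ, S ^ (n + 1) = (S * (1 - Q)) ^ (n + 1) + Q := by
    intro n
    have hSn : ∀ n : ℕ, S ^ n * Q = Q := by
      intro n
      induction n with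
      | zero => simp
      | succ n ih => rw [pow_succ, mul_assoc, hSQ, ih]
    rw [((Commute.one_right S).sub_right hScQ).mul_pow, hidem.pow_succ_eq, mul_sub, mul_one, hSn]
    abel
  rw [← tendsto_add_atTop_iff_nat 1]
  have h := ((tendsto_add_atTop_iff_nat 1).2
    (tendsto_pow_zero_of_spectralRadius_lt_one hrad)).add_const Q
  rw [zero_add] at h
  exact h.congr fun n => (hpow n).symm

end Dominant

/-! ### The real part and the positive cone. -/

namespace LatticeComplexification

variable {F E : Type*} [NormedAddCommGroup F] [NormedSpace ℝ F] [Lattice F] [IsOrderedAddMonoid F]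
  [IsOrderedModule ℝ F] [HasSolidNorm F]
  [NormedAddCommGroup E] [NormedSpace ℂ E] (J : LatticeComplexification F E)

/-- The modulus of a real element is `|x|`: the angles 0 and `π` give `x` and `-x`, and every `cos θ
• x` lies below `|x|`. -/
theorem norm_ofReal (x : F) : ‖J.ofReal x‖ = ‖x‖ := by
  obtain ⟨m, hm, hn⟩ := J.norm_eq_norm_modulus x 0
  have habs : m = |x| := by
    refine hm.unique ⟨?_, fun b hb => ?_⟩
    · rintro _ ⟨θ, rfl⟩
      simp only [smul_zero, add_zero]
      have h2 : |Real.cos θ| • |x| ≤ (1 : ℝ) • |x| :=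
        smul_le_smul_of_nonneg_right (Real.abs_cos_le_one θ) (abs_nonneg x)
      rw [one_smul] at h2
      refine le_trans ?_ h2
      rcases le_total 0 (Real.cos θ) with hθ | hθ
      · rw [abs_of_nonneg hθ]
        exact smul_le_smul_of_nonneg_left (le_abs_self x) hθ
      · rw [abs_of_nonpos hθ, ← neg_smul_neg]
        exact smul_le_smul_of_nonneg_left (neg_le_abs x) (neg_nonneg.2 hθ)
    · have h1 := hb ⟨0, rfl⟩
      have h2 := hb ⟨Real.pi, rfl⟩
      simp only [Real.cos_zero, Real.cos_pi, smul_zero, add_zero, one_smul, neg_smul] at h1 h2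
      exact sup_le h1 h2
  rw [habs, norm_abs_eq_norm] at hn
  simpa using hn

variable [CompleteSpace F]

/-- An isometry from a complete space is a closed embedding. -/
theorem isClosed_cone : IsClosed J.cone := by
  have hiso : Isometry J.ofReal := AddMonoidHomClass.isometry_of_norm J.ofReal J.norm_ofReal
  exact hiso.isClosedEmbedding.isClosedMap _ isClosed_Ici

end LatticeComplexification

end AsymptoticPositivity
namespace AsymptoticPositivity

theorem tendsto_ofReal_nhdsGT (l₀ : ℝ) :
    Tendsto (fun t : ℝ => (t : ℂ)) (𝓝[>] l₀) (𝓝[≠] (l₀ : ℂ)) := by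
  refine tendsto_nhdsWithin_iff.2
    ⟨(Complex.continuous_ofReal.tendsto l₀).mono_left nhdsWithin_le_nhds, ?_⟩
  filter_upwards [self_mem_nhdsWithin] with t ht
  have : t ≠ l₀ := ne_of_gt ht
  simpa using this

/-! ### Growth along the real axis. -/

section Growth

variable {E : Type*} [NormedAddCommGroup E] [NormedSpace ℂ E] {A : E →ₗ.[ℂ] E}
  {l₀ : ℝ} {Q : E →L[ℂ] E}

theorem tendsto_real_sub_smul_resolvent
    (hlim : Tendsto (fun z : ℂ => (z - l₀) • resolvent A z) (𝓝[≠] (l₀ : ℂ)) (𝓝 Q)) :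
    Tendsto (fun t : ℝ => (t - l₀) • resolvent A t) (𝓝[>] l₀) (𝓝 Q) := by
  refine (hlim.comp (tendsto_ofReal_nhdsGT l₀)).congr fun t => ?_
  rw [Function.comp_apply, ← Complex.ofReal_sub, Complex.coe_smul]

theorem abelGrowth_of_tendsto (h0 : (l₀ : ℂ) ∈ spectrum A)
    (hev : ∀ᶠ z in 𝓝[≠] (l₀ : ℂ), z ∈ resolventSet A)
    (hlim : Tendsto (fun z : ℂ => (z - l₀) • resolvent A z) (𝓝[≠] (l₀ : ℂ)) (𝓝 Q)) :
    AbelGrowth A l₀ := by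
  refine ⟨h0, ?_, ?_⟩
  · obtain ⟨u, hu, hsub⟩ := mem_nhdsGT_iff_exists_Ioc_subset.1
      ((tendsto_ofReal_nhdsGT l₀).eventually hev)
    exact ⟨u - l₀, sub_pos.2 hu, fun t ht => hsub (by simpa using ht)⟩
  · rw [(tendsto_real_sub_smul_resolvent hlim).enorm.limsup_eq]
    exact enorm_lt_top

end Growth

/-! ### Distance to the cone. -/

namespace LatticeComplexification

variable {F E : Type*} [NormedAddCommGroup F] [NormedSpace ℝ F] [Lattice F]
  [NormedAddCommGroup E] [NormedSpace ℂ E] (J : LatticeComplexification F E)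

theorem cone_nonempty : J.cone.Nonempty := ⟨_, 0, le_refl (0 : F), rfl⟩

theorem distPos_nonneg (f : E) : 0 ≤ J.distPos f := Metric.infDist_nonneg

theorem distPos_le_norm_sub {f g : E} (hg : g ∈ J.cone) : J.distPos f ≤ ‖f - g‖ := by
  rw [← dist_eq_norm]
  exact Metric.infDist_le_dist_of_mem hg

theorem continuous_distPos : Continuous J.distPos := Metric.continuous_infDist_pt _

theorem smul_mem_cone [IsOrderedAddMonoid F] [IsOrderedModule ℝ F] {c : ℝ} (hc : 0 ≤ c) {f : E}
    (hf : f ∈ J.cone) : c • f ∈ J.cone := by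
  obtain ⟨x, hx, rfl⟩ := hf
  exact ⟨c • x, smul_nonneg hc hx, map_smul _ _ _⟩

theorem distPos_smul_le [IsOrderedAddMonoid F] [IsOrderedModule ℝ F] {c : ℝ} (hc : 0 < c) (f : E) :
    J.distPos (c • f) ≤ c * J.distPos f := by
  have h := infDist_smul₀ hc.ne' J.cone f
  rw [Real.norm_of_nonneg hc.le] at h
  rw [distPos, distPos, ← h]
  refine Metric.infDist_le_infDist_of_subset ?_ (J.cone_nonempty.smul_set)
  rintro _ ⟨g, hg, rfl⟩
  exact J.smul_mem_cone hc.le hg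

theorem mem_cone_of_tendsto [IsOrderedAddMonoid F] [IsOrderedModule ℝ F] [HasSolidNorm F]
    [CompleteSpace F] {ι : Type*} {L : Filter ι} [L.NeBot] {u : ι → E} {f : E}
    (hu : Tendsto u L (𝓝 f)) (h : Tendsto (fun i => J.distPos (u i)) L (𝓝 0)) : f ∈ J.cone :=
  (J.isClosed_cone.mem_iff_infDist_zero J.cone_nonempty).2
    (tendsto_nhds_unique ((J.continuous_distPos.tendsto f).comp hu) h)

end LatticeComplexification

end AsymptoticPositivity

/-! ### The equivalences. -/

open AsymptoticPositivity in
theorem mainTheorem6 {F E : Type*}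
    [NormedAddCommGroup F] [NormedSpace ℝ F] [Lattice F] [IsOrderedAddMonoid F]
    [IsOrderedModule ℝ F] [HasSolidNorm F] [CompleteSpace F]
    [NormedAddCommGroup E] [NormedSpace ℂ E] [CompleteSpace E]
    (J : AsymptoticPositivity.LatticeComplexification F E)
    (A : E →ₗ.[ℂ] E) (hA : A.IsClosed)
    (l₀ : ℝ) (hl₀ : AsymptoticPositivity.IsSimplePole A (l₀ : ℂ)) :
    List.TFAE [
      J.IsPositive (AsymptoticPositivity.spectralProjection A (l₀ : ℂ)),
      J.ResolventIndivAsympPos A l₀,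
      J.ResolventUnifAsympPosBddType A l₀] ∧
    ((l₀ : EReal) = AsymptoticPositivity.spectralBound A →
      List.TFAE [
        J.IsPositive (AsymptoticPositivity.spectralProjection A (l₀ : ℂ)),
        J.ResolventIndivAsympPos A l₀,
        J.ResolventUnifAsympPosBddType A l₀,
        ∃ l : ℝ, AsymptoticPositivity.spectralBound A < (l : EReal) ∧
          J.IndivAsympPos (AsymptoticPositivity.resolvent A (l : ℂ)),
        ∀ l : ℝ, AsymptoticPositivity.spectralBound A < (l : EReal) →
          J.UnifAsympPos (AsymptoticPositivity.resolvent A (l : ℂ))]) := by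
  have h0 := hl₀.1
  have hev := hl₀.2.1
  obtain ⟨Q, H, hQ0, hH, hQ⟩ := hl₀.exists_laurent
  have hlim := tendsto_sub_smul_resolvent hH hQ
  have hAbel := abelGrowth_of_tendsto h0 hev hlim
  rw [spectralProjection_eq hev hlim]
  have h13 : J.IsPositive Q → J.ResolventUnifAsympPosBddType A l₀ := by
    intro hP
    have hbd : ∀ᶠ z in 𝓝[≠] (l₀ : ℂ), ‖H z‖ < ‖H l₀‖ + 1 :=
      (hH.norm.mono_left nhdsWithin_le_nhds).eventually (gt_mem_nhds (lt_add_one _))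
    -- On this interval the expansion holds and `‖H t‖` is bounded by the constant `K = ‖H l₀‖ + 1`.
    obtain ⟨u, hu, hsub⟩ := mem_nhdsGT_iff_exists_Ioc_subset.1
      ((tendsto_ofReal_nhdsGT l₀).eventually (hev.and (hQ.and hbd)))
    refine ⟨hAbel, u, hu, ‖H l₀‖ + 1, by positivity, fun t ht => (hsub ht).1, fun f hf t ht => ?_⟩
    obtain ⟨-, htQ, htH⟩ := hsub ht
    have hc : (0 : ℝ) ≤ (t - l₀)⁻¹ := inv_nonneg.2 (sub_nonneg.2 ht.1.le)
    refine (J.distPos_le_norm_sub (J.smul_mem_cone hc (hP f hf))).trans ?_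
    have heq : resolvent A t f - (t - l₀)⁻¹ • Q f = H t f := by
      rw [htQ, ← Complex.ofReal_sub, ← Complex.ofReal_inv, Complex.coe_smul]
      simp
    rw [heq]
    exact (H t).le_of_opNorm_le htH.le f
  have h32 : J.ResolventUnifAsympPosBddType A l₀ → J.ResolventIndivAsympPos A l₀ := by
    rintro ⟨hg, u, hu, K, -, -, hd⟩
    refine ⟨hg, fun f hf => ?_⟩
    have hz : Tendsto (fun t : ℝ => (t - l₀) * (K * ‖f‖)) (𝓝[>] l₀) (𝓝 0) := by
      have : ContinuousAt (fun t : ℝ => (t - l₀) * (K * ‖f‖)) l₀ := by fun_prop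
      simpa using this.tendsto.mono_left nhdsWithin_le_nhds
    have hmem : ∀ᶠ t in 𝓝[>] l₀, t ∈ Set.Ioc l₀ u := Ioc_mem_nhdsGT hu
    refine squeeze_zero' ?_ ?_ hz
    · filter_upwards [hmem] with t ht
      exact mul_nonneg (sub_nonneg.2 ht.1.le) (J.distPos_nonneg _)
    · filter_upwards [hmem] with t ht
      exact mul_le_mul_of_nonneg_left (hd f hf t ht) (sub_nonneg.2 ht.1.le)
  have h21 : J.ResolventIndivAsympPos A l₀ → J.IsPositive Q := by
    rintro ⟨-, h⟩ f hf
    refine J.mem_cone_of_tendsto ((ContinuousLinearMap.apply ℂ E f).continuous.tendsto Q |>.comp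
      (tendsto_real_sub_smul_resolvent hlim)) (squeeze_zero' (.of_forall fun _ => J.distPos_nonneg _)
      ?_ (h f hf))
    filter_upwards [self_mem_nhdsWithin] with t ht
    exact J.distPos_smul_le (sub_pos.2 ht) _
  refine ⟨by tfae_have 1 → 3 := h13
             tfae_have 3 → 2 := h32
             tfae_have 2 → 1 := h21
             tfae_finish, fun hs => ?_⟩
  have hσ : ∀ z ∈ spectrum A, z.re ≤ l₀ := fun z hz => by
    have : (z.re : EReal) ≤ l₀ := hs ▸ le_sSup ⟨z, hz, rfl⟩
    exact_mod_cast this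
  have hpow : ∀ l : ℝ, spectralBound A < l → spr (resolvent A l) = (l - l₀)⁻¹ ∧ l₀ < l ∧
      Tendsto (fun n => ((spr (resolvent A l))⁻¹ • resolvent A l) ^ n) atTop (𝓝 Q) := by
    intro l hl
    have hlt : l₀ < l := by rw [← hs] at hl; exact_mod_cast hl
    have hmem : (l : ℂ) ∈ resolventSet A := by
      by_contra hcon
      exact absurd (hσ _ hcon) (by simpa using hlt)
    have hspr := spr_resolvent hlt h0 hσ hmem
    refine ⟨hspr, hlt, ?_⟩
    rw [hspr, inv_inv, ← Complex.coe_smul, Complex.ofReal_sub]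
    exact tendsto_pow_resolvent hlt hσ hmem hev hQ0 hH hQ
  have h15 : J.IsPositive Q → ∀ l : ℝ, spectralBound A < l → J.UnifAsympPos (resolvent A l) := by
    intro hP l hl
    obtain ⟨hspr, hlt, ht⟩ := hpow l hl
    refine ⟨⟨by rw [hspr]; exact inv_pos.2 (sub_pos.2 hlt), ?_⟩, fun ε hε => ?_⟩
    -- Power boundedness comes from norm convergence of the powers.
    · obtain ⟨C, hC⟩ := ht.norm.bddAbove_range
      exact ⟨C, fun n => hC ⟨n, rfl⟩⟩
    · obtain ⟨N, hN⟩ := Metric.tendsto_atTop.1 ht ε hε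
      refine ⟨N, fun n hn f hf => (J.distPos_le_norm_sub (hP f hf)).trans ?_⟩
      have := hN n hn
      rw [dist_eq_norm] at this
      exact ContinuousLinearMap.le_of_opNorm_le _ this.le f
  have h54 : (∀ l : ℝ, spectralBound A < l → J.UnifAsympPos (resolvent A l)) →
      ∃ l : ℝ, spectralBound A < l ∧ J.IndivAsympPos (resolvent A l) := by
    intro h
    have hl : spectralBound A < ((l₀ + 1 : ℝ) : EReal) := by
      rw [← hs]; exact_mod_cast lt_add_one l₀
    obtain ⟨hb, hu⟩ := h _ hl
    refine ⟨_, hl, hb, fun f hf => Metric.tendsto_atTop.2 fun ε hε => ?_⟩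
    -- The added 1 covers `f = 0` and makes the final inequality strict.
    have hfp : 0 < ‖f‖ + 1 := by positivity
    obtain ⟨N, hN⟩ := hu (ε / (‖f‖ + 1)) (by positivity)
    refine ⟨N, fun n hn => ?_⟩
    rw [Real.dist_0_eq_abs, abs_of_nonneg (J.distPos_nonneg _)]
    refine (hN n hn f hf).trans_lt ?_
    rw [div_mul_eq_mul_div, div_lt_iff₀ hfp]
    exact mul_lt_mul_of_pos_left (lt_add_one _) hε
  have h41 : (∃ l : ℝ, spectralBound A < l ∧ J.IndivAsympPos (resolvent A l)) →
      J.IsPositive Q := by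
    rintro ⟨l, hl, -, h⟩ f hf
    exact J.mem_cone_of_tendsto
      ((ContinuousLinearMap.apply ℂ E f).continuous.tendsto Q |>.comp (hpow l hl).2.2) (h f hf)
  tfae_have 1 → 3 := h13
  tfae_have 3 → 2 := h32
  tfae_have 2 → 1 := h21
  tfae_have 1 → 5 := h15
  tfae_have 5 → 4 := h54
  tfae_have 4 → 1 := h41
  tfae_finish
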